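/- Let $d,\beta,\lambda,\rho>0$ and $\alpha\ge 0$. **Bulk.** For $0<L\le\infty$ let $\Omega_L=\{(x,y): x,y\in[0,\infty),\ x,y\le L,\ |x-y|\le d\}$, $\Omega=\Omega_\infty$, and let $L^2_a(\Omega_L)$ be the space of $\varphi\in L^2(\Omega_L)$ with $\varphi(x,y)=-\varphi(y,x)$. Let $H_p^L$ be the self-adjoint operator $-\partial_x^2-\partial_y^2$ on $L^2_a(\Omega_L)$ defined by the quadratic form $\int_{\Omega_L}|\nabla\varphi|^2$ on the functions in $H^1(\Omega_L)\cap L^2_a(\Omega_L)$ which vanish on $|x-y|=d$ and, if $L<\infty$, on $x=L$ and $y=L$; on the part of the boundary where $x=0$ or $y=0$ either Dirichlet or Neumann conditions are imposed (the same choice for all $L$). For $L<\infty$ let $E_0(L)\le E_1(L)\le\dots$ be the eigenvalues of $H_p^L$ counted with multiplicity, with an orthonormal basis $(\varphi_m)_{m\ge 0}$ of eigenfunctions, and let $E_0=\inf\sigma(H_p^\infty)$. **Surface.** Let $(e_i)_{i\in\mathbb N}\subset[0,\infty)$ be arbitrary and let $n(L)\ge 1$ be integers (the number of surface defects up to length $L$).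 Let $\lambda_1(L),\dots,\lambda_{n(L)}(L)\ge0$ be the eigenvalues, counted with multiplicity, of the graph Laplacian $(\mathcal Lf)(i)=\sum_j\gamma_{ij}(f(i)-f(j))$ of the path graph with $n(L)$ vertices, whose $i$-th edge has weight $e_i$. **Thermodynamic limit.** Let $L_k\to\infty$ be a sequence of positive lengths with $L_k/n(L_k)\to\delta\in[0,\infty)$, and let the chemical potentials $\mu_L\in\mathbb R$ and surface pair densities $\rho_s(L)$ satisfy, for all $L=L_k$, $$\mu_L<\min\{\lambda\rho_s(L)-\alpha,\ E_0(L)\},\qquad \rho_s(L)=\frac1{n(L)}\sum_{j=1}^{n(L)}\frac1{e^{\beta[\lambda_j(L)-\alpha+\lambda\rho_s(L)-\mu_L]}-1},$$ and $$\rho=\lim_{k\to\infty}\frac1{L_k}\left(\sum_{j=1}^{n(L_k)}\frac1{e^{\beta[\lambda_j(L_k)-\alpha+\lambda\rho_s(L_k)-\mu_{L_k}]}-1}+\sum_{m=0}^\infty\frac1{e^{\beta(E_m(L_k)-\mu_{L_k})}-1}\right).$$ Then the following hold. For Dirichlet conditions at the end of the wire, $E_0=2\pi^2/d^2$. If $\delta=0$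 then, for every $\lambda>0$, $$\lim_{k\to\infty}\frac1{L_k}\,\frac1{e^{\beta(E_m(L_k)-\mu_{L_k})}-1}=0\qquad\text{for all } m\in\mathbb N_0,\tag{$*$}$$ that is, the condensate in the bulk is destroyed. More generally, $(*)$ holds whenever $$\delta\rho<\frac{E_0+\alpha}{\nu\lambda}\quad\text{for some }\nu>1 .$$ -/

import Mathlib

open MeasureTheory Filter Topology
open scoped ENNReal ContDiff

/-! ### The bulk: a bound pair of electrons on the wire -/

/-- Boundary condition of the pair Hamiltonian where one of the two electrons sits at the end
point `0` of the wire. -/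
inductive EndCondition
  | dirichlet
  | neumann

/-- The wire `[0, L]` for real `L`, and the half-line `[0, ∞)` for `L = ⊤`. -/
def wire (L : EReal) : Set ℝ := {x | 0 ≤ x ∧ (x : EReal) ≤ L}

/-- The two-particle configuration space `{(x, y) | x, y ∈ wire, |x - y| ≤ d}`:
`Ω` for `L = ⊤` and `Ω_L` for real `L`. -/
def pairRegion (d : ℝ) (L : EReal) : Set (ℝ × ℝ) :=
  {p | p.1 ∈ wire L ∧ p.2 ∈ wire L ∧ |p.1 - p.2| ≤ d}

/-- The space `L²(Ω_L)` of complex valued functions. -/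
abbrev PairL2 (d : ℝ) (L : EReal) : Type :=
  Lp ℂ 2 ((volume : Measure (ℝ × ℝ)).restrict (pairRegion d L))

/-- `φ(x, y) = -φ(y, x)`, i.e. `φ` belongs to the subspace `L²_a(Ω_L)`. -/
def IsAntisymmetric {d : ℝ} {L : EReal} (φ : PairL2 d L) : Prop :=
  ∀ᵐ p ∂((volume : Measure (ℝ × ℝ)).restrict (pairRegion d L)), φ p.swap = -φ p

/-- The open set in which test functions are supported. It keeps away from `|x - y| = d`
(the pair never breaks up), from `x = L` and `y = L` (Dirichlet condition at the cut) and, for the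
Dirichlet condition at the end of the wire, also from `x = 0` and `y = 0`. For the Neumann
condition the region continues across the axes, so that nothing is imposed there on the
restrictions of test functions to `Ω_L`. -/
def testRegion (bc : EndCondition) (d : ℝ) (L : EReal) : Set (ℝ × ℝ) :=
  {p | (p.1 : EReal) < L ∧ (p.2 : EReal) < L ∧ |p.1 - p.2| < d ∧
    (bc = EndCondition.dirichlet → 0 < p.1 ∧ 0 < p.2)}

/-- Smooth antisymmetric functions with compact support in the test region. -/
structure IsPairTest (bc : EndCondition) (d : ℝ) (L : EReal) (u : ℝ × ℝ → ℂ) : Prop where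
  smooth : ContDiff ℝ ∞ u
  compactSupport : HasCompactSupport u
  support_subset : tsupport u ⊆ testRegion bc d L
  antisymmetric : ∀ p, u p.swap = -u p

/-- The closed quadratic form of `H_p` on `L²_a(Ω_L)`, given by its graph: the closure in
`L² × L² × L²` of the triples `(u, ∂ₓu, ∂ᵧu)` with `u` a test function. A triple `(φ, g₁, g₂)` of
this set is an element `φ` of the form domain, a closed subspace of the Sobolev space `H¹(Ω_L)`,
with its weak gradient `(g₁, g₂)`. -/
def pairFormGraph (bc : EndCondition) (d : ℝ) (L : EReal) :
    Set (PairL2 d L × PairL2 d L × PairL2 d L) :=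
  closure {T | ∃ u : ℝ × ℝ → ℂ, IsPairTest bc d L u ∧
    T.1 =ᵐ[(volume : Measure (ℝ × ℝ)).restrict (pairRegion d L)] u ∧
    T.2.1 =ᵐ[(volume : Measure (ℝ × ℝ)).restrict (pairRegion d L)]
      (fun p => fderiv ℝ u p (1, 0)) ∧
    T.2.2 =ᵐ[(volume : Measure (ℝ × ℝ)).restrict (pairRegion d L)]
      (fun p => fderiv ℝ u p (0, 1))}

/-- `H_p φ = E φ` for the self-adjoint operator `H_p = -∂²/∂x² - ∂²/∂y²` of the form above:
`φ` lies in the form domain and `⟨∇w, ∇φ⟩ = E ⟨w, φ⟩` for all `w` in the form domain. -/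
def IsPairEigenfunction (bc : EndCondition) (d : ℝ) (L : EReal) (E : ℝ) (φ : PairL2 d L) : Prop :=
  ∃ g₁ g₂ : PairL2 d L, (φ, g₁, g₂) ∈ pairFormGraph bc d L ∧
    ∀ w h₁ h₂ : PairL2 d L, (w, h₁, h₂) ∈ pairFormGraph bc d L →
      inner ℂ h₁ g₁ + inner ℂ h₂ g₂ = (E : ℂ) * inner ℂ w φ

/-- `E 0 ≤ E 1 ≤ …` are the eigenvalues of `H_p` on `L²_a(Ω_L)`, counted with multiplicity, and
`φ 0, φ 1, …` is a corresponding orthonormal basis of eigenfunctions of `L²_a(Ω_L)`. -/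
structure IsPairEigensystem (bc : EndCondition) (d : ℝ) (L : EReal)
    (E : ℕ → ℝ) (φ : ℕ → PairL2 d L) : Prop where
  monotone : Monotone E
  orthonormal : Orthonormal ℂ φ
  eigen : ∀ m, IsPairEigenfunction bc d L (E m) (φ m)
  complete : ∀ f : PairL2 d L, IsAntisymmetric f → (∀ m, inner ℂ (φ m) f = 0) → f = 0

/-- `E₀ = inf σ(H_p)` for the pair Hamiltonian on the half-line: the infimum of the energy
`‖∇φ‖²` over the normalised elements `φ` of the form domain in `L²_a(Ω)`. -/
noncomputable def bulkGroundEnergy (bc : EndCondition) (d : ℝ) : ℝ :=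
  sInf {q | ∃ φ g₁ g₂ : PairL2 d ⊤, (φ, g₁, g₂) ∈ pairFormGraph bc d ⊤ ∧ ‖φ‖ = 1 ∧
    q = ‖g₁‖ ^ 2 + ‖g₂‖ ^ 2}

/-! ### The surface defects: a weighted path graph -/

/-- Edge weights of the path graph: the edge `{i, i + 1}` has weight `e i`. -/
def pathWeight (e : ℕ → ℝ) (i j : ℕ) : ℝ :=
  if j = i + 1 then e i else if i = j + 1 then e j else 0

theorem pathWeight_comm (e : ℕ → ℝ) (i j : ℕ) : pathWeight e i j = pathWeight e j i := by
  unfold pathWeight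
  split_ifs <;> first | rfl | omega

/-- The weighted graph Laplacian `(𝓛 f)(i) = ∑ⱼ γᵢⱼ (f(i) - f(j))` of the path graph with `N`
vertices, as a matrix; it is positive semidefinite with lowest eigenvalue `0`. -/
def pathLaplacian (e : ℕ → ℝ) (N : ℕ) : Matrix (Fin N) (Fin N) ℝ :=
  Matrix.diagonal (fun i : Fin N => ∑ j : Fin N, pathWeight e i j) -
    Matrix.of (fun i j : Fin N => pathWeight e i j)

theorem pathLaplacian_isHermitian (e : ℕ → ℝ) (N : ℕ) : (pathLaplacian e N).IsHermitian := by
  unfold pathLaplacian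
  refine Matrix.IsHermitian.sub (Matrix.isHermitian_diagonal _) ?_
  ext i j
  simp [pathWeight_comm e j i]

/-! ### Occupation numbers -/

/-- The expected number of pairs in a state with energy `x` above the chemical potential. -/
noncomputable def boseOccupation (β x : ℝ) : ℝ := 1 / (Real.exp (β * x) - 1)

/-- The expected number of pairs in `N` surface defects, with the energies `λⱼ - α + lam * ρs`,
where the `λⱼ` are the eigenvalues of the graph Laplacian counted with multiplicity. -/
noncomputable def surfaceNumber (β α lam : ℝ) (e : ℕ → ℝ) (N : ℕ) (μ ρs : ℝ) : ℝ :=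
  ∑ j : Fin N, boseOccupation β
    (((pathLaplacian_isHermitian e N).eigenvalues j - α + lam * ρs) - μ)

/-- The expected number of pairs in the bulk, for bulk eigenvalues `E` and `μ < E 0`. -/
noncomputable def bulkNumber (β : ℝ) (E : ℕ → ℝ) (μ : ℝ) : ℝ≥0∞ :=
  ∑' m : ℕ, ENNReal.ofReal (boseOccupation β (E m - μ))

/-!
The condensate is destroyed because the surface holds the chemical potential below the bulk
spectrum. The number of pairs in the bulk is nonnegative, so the surface contains at most
`(ρ + o(1)) L` pairs, and its density per defect satisfies `ρ_s(L) ≤ (L / n(L)) (ρ + o(1)) → δ ρ`. From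
`μ_L < lam ρ_s(L) - α` one gets `limsup μ_L ≤ lam δ ρ - α`, which is smaller than `E₀` under either
assumption. On the other hand every bulk eigenvalue satisfies `E_m(L) ≥ E₀`
(`bulkGroundEnergy_le_eigenvalue`): a test function for `Ω_L` is one for `Ω`. Hence
`E_m(L) - μ_L` is bounded below by a positive constant, the occupation number of each bulk state is
bounded, and divided by `L` it tends to `0` (`condensate_destroyed`).

For `δ = 0` and `α = 0` this needs `E₀ > 0` for both boundary conditions. The value of `E₀` for the
Dirichlet condition and its positivity for the Neumann condition come from the same lower bound,
`IsPairTest.lower_bound`. On each segment `x + y = s` of `Ω`, of half-length at most `d / 2` in the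
parameter `τ` of the point `(s / 2 + τ, s / 2 - τ)`, an antisymmetric function vanishes at the
midpoint, and for the Dirichlet condition also at the end points. The sharp Poincaré inequality
(`poincare_interval`) and `|∂ₓu|² + |∂ᵧu|² ≥ |∂ₓu - ∂ᵧu|² / 2` give the bound `2 π² / d²` for
Dirichlet and `π² / (2 d²)` for Neumann conditions.

The Dirichlet value is attained in the limit by `h(x - y) ψ(x + y)`, where `h` is `sin (π t / d)`
smoothly cut off near its zeros and `ψ` is a bump far away from the axes spread over a long interval
(`bulkGroundEnergy_dirichlet_le`).
-/

/-! ### Energies of test functions -/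

/-- The kinetic energy `∫_S |∇u|²` of a smooth function on a set `S` of the plane. -/
noncomputable def dirichletEnergy (S : Set (ℝ × ℝ)) (u : ℝ × ℝ → ℂ) : ℝ :=
  ∫ p in S, (‖fderiv ℝ u p (1, 0)‖ ^ 2 + ‖fderiv ℝ u p (0, 1)‖ ^ 2)

theorem norm_sq_eq_setIntegral {d : ℝ} {L : EReal} {φ : PairL2 d L} {u : ℝ × ℝ → ℂ}
    (h : φ =ᵐ[(volume : Measure (ℝ × ℝ)).restrict (pairRegion d L)] u) :
    ‖φ‖ ^ 2 = ∫ p in pairRegion d L, ‖u p‖ ^ 2 := by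
  have h1 : inner ℂ φ φ = ((‖φ‖ ^ 2 : ℝ) : ℂ) := by
    rw [inner_self_eq_norm_sq_to_K]; norm_cast
  rw [L2.inner_def] at h1
  have h2 : ∫ a in pairRegion d L, inner ℂ (φ a) (φ a)
      = ∫ p in pairRegion d L, ((‖u p‖ ^ 2 : ℝ) : ℂ) := by
    refine integral_congr_ae ?_
    filter_upwards [h] with p hp
    rw [hp, inner_self_eq_norm_sq_to_K]; norm_cast
  rw [h2, integral_complex_ofReal] at h1
  exact_mod_cast h1.symm

theorem measurableSet_pairRegion_top (d : ℝ) : MeasurableSet (pairRegion d ⊤) := by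
  have : pairRegion d ⊤ = {p | 0 ≤ p.1} ∩ {p | 0 ≤ p.2} ∩ {p | |p.1 - p.2| ≤ d} := by
    ext p; simp [pairRegion, wire, and_assoc]
  rw [this]
  refine ((isClosed_le ?_ ?_).inter (isClosed_le ?_ ?_)).inter (isClosed_le ?_ ?_)
    |>.measurableSet <;> fun_prop

namespace IsPairTest

variable {bc : EndCondition} {d : ℝ} {L : EReal} {u : ℝ × ℝ → ℂ}

theorem eq_zero_of_notMem (hu : IsPairTest bc d L u) {p : ℝ × ℝ} (hp : p ∉ testRegion bc d L) :
    u p = 0 :=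
  image_eq_zero_of_notMem_tsupport fun h => hp (hu.support_subset h)

theorem fderiv_eq_zero_of_notMem (hu : IsPairTest bc d L u) {p : ℝ × ℝ}
    (hp : p ∉ testRegion bc d L) : fderiv ℝ u p = 0 :=
  fderiv_of_notMem_tsupport ℝ fun h => hp (hu.support_subset h)

theorem continuous_fderiv_apply (hu : IsPairTest bc d L u) (v : ℝ × ℝ) :
    Continuous fun p => fderiv ℝ u p v :=
  (hu.smooth.continuous_fderiv (by simp)).clm_apply continuous_const

theorem hasCompactSupport_fderiv_apply (hu : IsPairTest bc d L u) (v : ℝ × ℝ) :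
    HasCompactSupport fun p => fderiv ℝ u p v :=
  hu.compactSupport.fderiv_apply ℝ v

theorem integrable_norm_sq (hu : IsPairTest bc d L u) : Integrable fun p => ‖u p‖ ^ 2 :=
  (memLp_two_iff_integrable_sq_norm hu.smooth.continuous.aestronglyMeasurable).1
    (hu.smooth.continuous.memLp_of_hasCompactSupport hu.compactSupport)

theorem integrable_norm_sq_fderiv (hu : IsPairTest bc d L u) (v : ℝ × ℝ) :
    Integrable fun p => ‖fderiv ℝ u p v‖ ^ 2 :=
  (memLp_two_iff_integrable_sq_norm (hu.continuous_fderiv_apply v).aestronglyMeasurable).1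
    ((hu.continuous_fderiv_apply v).memLp_of_hasCompactSupport
      (hu.hasCompactSupport_fderiv_apply v))

theorem dirichletEnergy_eq (hu : IsPairTest bc d L u) (S : Set (ℝ × ℝ)) :
    dirichletEnergy S u =
      (∫ p in S, ‖fderiv ℝ u p (1, 0)‖ ^ 2) + ∫ p in S, ‖fderiv ℝ u p (0, 1)‖ ^ 2 :=
  integral_add (hu.integrable_norm_sq_fderiv _).integrableOn
    (hu.integrable_norm_sq_fderiv _).integrableOn

theorem const_mul (hu : IsPairTest bc d L u) (c : ℂ) : IsPairTest bc d L fun p => c * u p where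
  smooth := contDiff_const.mul hu.smooth
  compactSupport := hu.compactSupport.mul_left
  support_subset := (tsupport_mul_subset_right (f := fun _ => c)).trans hu.support_subset
  antisymmetric p := by rw [hu.antisymmetric]; ring

theorem mono_top (hu : IsPairTest bc d L u) : IsPairTest bc d ⊤ u where
  smooth := hu.smooth
  compactSupport := hu.compactSupport
  support_subset := fun p hp => by
    obtain ⟨-, -, h3, h4⟩ := hu.support_subset hp
    exact ⟨EReal.coe_lt_top _, EReal.coe_lt_top _, h3, h4⟩
  antisymmetric := hu.antisymmetric

theorem of_dirichlet (hu : IsPairTest EndCondition.dirichlet d L u) : IsPairTest bc d L u where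
  smooth := hu.smooth
  compactSupport := hu.compactSupport
  support_subset := fun p hp => by
    obtain ⟨h1, h2, h3, h4⟩ := hu.support_subset hp
    exact ⟨h1, h2, h3, fun _ => h4 rfl⟩
  antisymmetric := hu.antisymmetric

/-- The triple `(u, ∂ₓu, ∂ᵧu)` of a test function, seen in the graph of the form. -/
theorem exists_mem_pairFormGraph (hu : IsPairTest bc d L u) :
    ∃ φ g₁ g₂ : PairL2 d L, (φ, g₁, g₂) ∈ pairFormGraph bc d L ∧
      ‖φ‖ ^ 2 = (∫ p in pairRegion d L, ‖u p‖ ^ 2) ∧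
      ‖g₁‖ ^ 2 + ‖g₂‖ ^ 2 = dirichletEnergy (pairRegion d L) u := by
  have m0 : MemLp u 2 ((volume : Measure (ℝ × ℝ)).restrict (pairRegion d L)) :=
    (hu.smooth.continuous.memLp_of_hasCompactSupport hu.compactSupport).restrict _
  have m1 (v : ℝ × ℝ) : MemLp (fun p => fderiv ℝ u p v) 2
      ((volume : Measure (ℝ × ℝ)).restrict (pairRegion d L)) :=
    ((hu.continuous_fderiv_apply v).memLp_of_hasCompactSupport
      (hu.hasCompactSupport_fderiv_apply v)).restrict _
  refine ⟨m0.toLp u, (m1 (1, 0)).toLp _, (m1 (0, 1)).toLp _, subset_closure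
    ⟨u, hu, m0.coeFn_toLp, (m1 _).coeFn_toLp, (m1 _).coeFn_toLp⟩,
    norm_sq_eq_setIntegral m0.coeFn_toLp, ?_⟩
  rw [norm_sq_eq_setIntegral (m1 (1, 0)).coeFn_toLp, norm_sq_eq_setIntegral (m1 (0, 1)).coeFn_toLp,
    hu.dirichletEnergy_eq]

/-- A test function for `Ω_L` vanishes on `Ω \ Ω_L`. -/
theorem setIntegral_pairRegion_eq_top (hu : IsPairTest bc d L u) :
    (∫ p in pairRegion d L, ‖u p‖ ^ 2) = (∫ p in pairRegion d ⊤, ‖u p‖ ^ 2) ∧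
      dirichletEnergy (pairRegion d L) u = dirichletEnergy (pairRegion d ⊤) u := by
  have hm := measurableSet_pairRegion_top d
  have hsub : pairRegion d L ⊆ pairRegion d ⊤ := fun p hp =>
    ⟨⟨hp.1.1, le_top⟩, ⟨hp.2.1.1, le_top⟩, hp.2.2⟩
  have hz : ∀ p ∈ pairRegion d ⊤ \ pairRegion d L, p ∉ testRegion bc d L := fun p hp ht =>
    hp.2 ⟨⟨hp.1.1.1, ht.1.le⟩, ⟨hp.1.2.1.1, ht.2.1.le⟩, hp.1.2.2⟩
  constructor
  · exact (setIntegral_eq_of_subset_of_forall_sdiff_eq_zero hm hsub fun p hp => by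
      simp [hu.eq_zero_of_notMem (hz p hp)]).symm
  · exact (setIntegral_eq_of_subset_of_forall_sdiff_eq_zero hm hsub fun p hp => by
      simp [hu.fderiv_eq_zero_of_notMem (hz p hp)]).symm

end IsPairTest

/-- A lower bound for the form on test functions extends to the whole form domain. -/
theorem le_form_of_le_on_tests {bc : EndCondition} {d : ℝ} {L : EReal} {c : ℝ}
    (h : ∀ u, IsPairTest bc d L u →
      c * (∫ p in pairRegion d L, ‖u p‖ ^ 2) ≤ dirichletEnergy (pairRegion d L) u)
    {φ g₁ g₂ : PairL2 d L} (hφ : (φ, g₁, g₂) ∈ pairFormGraph bc d L) :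
    c * ‖φ‖ ^ 2 ≤ ‖g₁‖ ^ 2 + ‖g₂‖ ^ 2 := by
  have hcl : IsClosed {T : PairL2 d L × PairL2 d L × PairL2 d L |
      c * ‖T.1‖ ^ 2 ≤ ‖T.2.1‖ ^ 2 + ‖T.2.2‖ ^ 2} :=
    isClosed_le ((continuous_fst.norm.pow 2).const_mul c)
      ((continuous_snd.fst.norm.pow 2).add (continuous_snd.snd.norm.pow 2))
  have key : pairFormGraph bc d L ⊆ {T | c * ‖T.1‖ ^ 2 ≤ ‖T.2.1‖ ^ 2 + ‖T.2.2‖ ^ 2} := by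
    unfold pairFormGraph
    rw [hcl.closure_subset_iff]
    rintro T ⟨u, hu, h0, h1, h2⟩
    rw [Set.mem_ofPred_eq, norm_sq_eq_setIntegral h0, norm_sq_eq_setIntegral h1,
      norm_sq_eq_setIntegral h2, ← hu.dirichletEnergy_eq]
    exact h u hu
  have hmem := key hφ
  rwa [Set.mem_ofPred_eq] at hmem

theorem dirichletEnergy_nonneg (S : Set (ℝ × ℝ)) (u : ℝ × ℝ → ℂ) : 0 ≤ dirichletEnergy S u :=
  integral_nonneg fun _ => by positivity

/-- The Rayleigh principle for test functions on `Ω`, which may be scaled to norm `1` unless they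
vanish on `Ω`. -/
theorem bulkGroundEnergy_mul_le {bc : EndCondition} {d : ℝ} {u : ℝ × ℝ → ℂ}
    (hu : IsPairTest bc d ⊤ u) :
    bulkGroundEnergy bc d * (∫ p in pairRegion d ⊤, ‖u p‖ ^ 2) ≤
      dirichletEnergy (pairRegion d ⊤) u := by
  set N := ∫ p in pairRegion d ⊤, ‖u p‖ ^ 2 with hN
  have hN0 : 0 ≤ N := integral_nonneg fun _ => by positivity
  rcases hN0.eq_or_lt with h0 | hpos
  · rw [← h0, mul_zero]; exact dirichletEnergy_nonneg _ _
  set c : ℂ := (((Real.sqrt N)⁻¹ : ℝ) : ℂ) with hc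
  have hc2 : ‖c‖ ^ 2 = N⁻¹ := by
    rw [hc, Complex.norm_real, Real.norm_eq_abs, sq_abs, inv_pow, Real.sq_sqrt hN0]
  obtain ⟨φ, g₁, g₂, hmem, hφ, hg⟩ := (hu.const_mul c).exists_mem_pairFormGraph
  have hd (p : ℝ × ℝ) : fderiv ℝ (fun p => c * u p) p = c • fderiv ℝ u p :=
    fderiv_const_mul (hu.smooth.differentiable (by simp) p) c
  have e1 : ∫ p in pairRegion d ⊤, ‖c * u p‖ ^ 2 = 1 := by
    simp_rw [norm_mul, mul_pow, hc2]
    rw [integral_const_mul, ← hN, inv_mul_cancel₀ hpos.ne']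
  have e2 : dirichletEnergy (pairRegion d ⊤) (fun p => c * u p)
      = N⁻¹ * dirichletEnergy (pairRegion d ⊤) u := by
    unfold dirichletEnergy
    rw [← integral_const_mul]
    congr 1 with p
    rw [hd]
    simp only [smul_apply, norm_smul, mul_pow, hc2]
    ring
  have hle : bulkGroundEnergy bc d ≤ ‖g₁‖ ^ 2 + ‖g₂‖ ^ 2 := by
    refine csInf_le ⟨0, ?_⟩ ⟨φ, g₁, g₂, hmem, ?_, rfl⟩
    · rintro q ⟨_, _, _, _, _, rfl⟩; positivity
    · rw [e1] at hφ
      exact (pow_eq_one_iff_of_nonneg (norm_nonneg φ) two_ne_zero).1 hφ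
  rw [hg, e2] at hle
  rwa [inv_mul_eq_div, le_div_iff₀ hpos] at hle

/-- Dirichlet bracketing: cutting the wire at `L` with a Dirichlet condition does not lower the
energies below the ground state energy of the half-line. -/
theorem bulkGroundEnergy_le_eigenvalue {bc : EndCondition} {d : ℝ} {L : EReal} {E : ℝ}
    {φ : PairL2 d L} (hφ : ‖φ‖ = 1) (h : IsPairEigenfunction bc d L E φ) :
    bulkGroundEnergy bc d ≤ E := by
  obtain ⟨g₁, g₂, hmem, heq⟩ := h
  have h1 := heq φ g₁ g₂ hmem
  simp only [inner_self_eq_norm_sq_to_K, hφ] at h1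
  have h2 : ‖g₁‖ ^ 2 + ‖g₂‖ ^ 2 = E := by
    have : ((‖g₁‖ ^ 2 + ‖g₂‖ ^ 2 : ℝ) : ℂ) = (E : ℂ) := by
      push_cast; simpa using h1
    exact_mod_cast this
  have h3 := le_form_of_le_on_tests (c := bulkGroundEnergy bc d) (fun u hu => by
    rw [hu.setIntegral_pairRegion_eq_top.1, hu.setIntegral_pairRegion_eq_top.2]
    exact bulkGroundEnergy_mul_le hu.mono_top) hmem
  rw [hφ, h2] at h3
  linarith

/-- The infimum is taken over a nonempty set as soon as one test function does not vanish
on `Ω`. -/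
theorem le_bulkGroundEnergy {bc : EndCondition} {d c : ℝ}
    (h : ∀ u, IsPairTest bc d ⊤ u →
      c * (∫ p in pairRegion d ⊤, ‖u p‖ ^ 2) ≤ dirichletEnergy (pairRegion d ⊤) u)
    (hne : ∃ u, IsPairTest bc d ⊤ u ∧ 0 < ∫ p in pairRegion d ⊤, ‖u p‖ ^ 2) :
    c ≤ bulkGroundEnergy bc d := by
  refine le_csInf ?_ ?_
  · obtain ⟨u, hu, hpos⟩ := hne
    set N := ∫ p in pairRegion d ⊤, ‖u p‖ ^ 2 with hN
    obtain ⟨φ, g₁, g₂, hmem, hφ, -⟩ :=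
      (hu.const_mul (((Real.sqrt N)⁻¹ : ℝ) : ℂ)).exists_mem_pairFormGraph
    refine ⟨_, φ, g₁, g₂, hmem, ?_, rfl⟩
    simp_rw [norm_mul, mul_pow, Complex.norm_real, Real.norm_eq_abs, sq_abs, inv_pow,
      Real.sq_sqrt hpos.le] at hφ
    rw [integral_const_mul, ← hN, inv_mul_cancel₀ hpos.ne'] at hφ
    exact (pow_eq_one_iff_of_nonneg (norm_nonneg φ) two_ne_zero).1 hφ
  · rintro q ⟨φ, g₁, g₂, hmem, hφ, rfl⟩
    have := le_form_of_le_on_tests h hmem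
    rwa [hφ, one_pow, mul_one] at this

/-! ### Lower bound for the form -/

/-- The one-dimensional Poincaré inequality on `[0, w]` with a Dirichlet condition at `0` and a
Dirichlet or (for `κ w ≤ π / 2`) a free condition at `w`, in the weaker form with a constant
`κ' < κ`. With the Riccati solution `c = κ' cot (κ' t + η)`, `c' = -κ'² - c²`, one has
`‖f'‖² - κ'² ‖f‖² = ‖f' - c f‖² + (c ‖f‖²)'`; the slack `κ - κ'` makes room for a shift `η`
that keeps the poles of `c` outside `[0, w]`. -/
theorem poincare_interval_of_lt {F : Type*} [NormedAddCommGroup F] [InnerProductSpace ℝ F]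
    {f f' : ℝ → F} (hf : ∀ t, HasDerivAt f (f' t) t) (hf' : Continuous f') (h0 : f 0 = 0)
    {w κ κ' : ℝ} (hw : 0 < w) (hκ' : 0 < κ') (hlt : κ' < κ) (hκw : κ * w ≤ Real.pi)
    (hend : f w = 0 ∨ κ * w ≤ Real.pi / 2) :
    κ' ^ 2 * (∫ t in (0 : ℝ)..w, ‖f t‖ ^ 2) ≤ ∫ t in (0 : ℝ)..w, ‖f' t‖ ^ 2 := by
  have hfc : Continuous f := continuous_iff_continuousAt.2 fun t => (hf t).continuousAt
  set η := (κ - κ') * w / 2 with hη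
  have hηpos : 0 < η := by
    have := mul_pos (sub_pos.2 hlt) hw
    positivity
  have hηw : κ' * w + η < κ * w := by nlinarith
  set c : ℝ → ℝ := fun t => κ' * (Real.cos (κ' * t + η) / Real.sin (κ' * t + η)) with hc
  have hsin : ∀ t ∈ Set.Icc 0 w, 0 < Real.sin (κ' * t + η) := fun t ht =>
    Real.sin_pos_of_pos_of_lt_pi (by nlinarith [mul_nonneg hκ'.le ht.1])
      (by nlinarith [mul_le_mul_of_nonneg_left ht.2 hκ'.le])
  have hcd : ∀ t ∈ Set.Icc 0 w, HasDerivAt c (-κ' ^ 2 - c t ^ 2) t := fun t ht => by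
    have hs := (hsin t ht).ne'
    have hl : HasDerivAt (fun t => κ' * t + η) κ' t := by
      simpa using ((hasDerivAt_id t).const_mul κ').add_const η
    convert! ((hl.cos.div hl.sin hs).const_mul κ') using 1
    simp only [hc]
    field_simp
  have hG : ∀ t ∈ Set.Icc 0 w, HasDerivAt (fun t => c t * ‖f t‖ ^ 2)
      ((-κ' ^ 2 - c t ^ 2) * ‖f t‖ ^ 2 + c t * (2 * inner ℝ (f t) (f' t))) t := fun t ht =>
    (hcd t ht).mul (hf t).norm_sq
  have key := intervalIntegral.sub_le_integral_of_hasDeriv_right_of_le hw.le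
    (fun t ht => (hG t ht).continuousAt.continuousWithinAt)
    (fun t ht => (hG t (Set.Ioo_subset_Icc_self ht)).hasDerivWithinAt)
    (φ := fun t => ‖f' t‖ ^ 2 - κ' ^ 2 * ‖f t‖ ^ 2)
    (Continuous.integrableOn_Icc (by fun_prop))
    (fun t _ => by
      have h1 : 0 ≤ ‖f' t - c t • f t‖ ^ 2 := by positivity
      rw [norm_sub_sq_real, norm_smul, mul_pow, Real.norm_eq_abs, sq_abs, inner_smul_right,
        real_inner_comm] at h1
      linarith)
  rw [intervalIntegral.integral_sub (Continuous.intervalIntegrable (by fun_prop) _ _)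
    (Continuous.intervalIntegrable (by fun_prop) _ _), intervalIntegral.integral_const_mul] at key
  have hb : 0 ≤ c w * ‖f w‖ ^ 2 := by
    rcases hend with h | h
    · simp [h]
    · have h1 := hsin w (Set.right_mem_Icc.2 hw.le)
      have h2 : 0 ≤ Real.cos (κ' * w + η) :=
        Real.cos_nonneg_of_mem_Icc ⟨by nlinarith [Real.pi_pos], by linarith⟩
      positivity
  simp only [h0, norm_zero] at key
  linarith

theorem poincare_interval {F : Type*} [NormedAddCommGroup F] [InnerProductSpace ℝ F]
    {f f' : ℝ → F} (hf : ∀ t, HasDerivAt f (f' t) t) (hf' : Continuous f') (h0 : f 0 = 0)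
    {w κ : ℝ} (hw : 0 ≤ w) (hκ : 0 < κ) (hκw : κ * w ≤ Real.pi)
    (hend : f w = 0 ∨ κ * w ≤ Real.pi / 2) :
    κ ^ 2 * (∫ t in (0 : ℝ)..w, ‖f t‖ ^ 2) ≤ ∫ t in (0 : ℝ)..w, ‖f' t‖ ^ 2 := by
  rcases hw.eq_or_lt with rfl | hw
  · simp
  have hlim : Tendsto (fun κ' : ℝ => κ' ^ 2 * (∫ t in (0 : ℝ)..w, ‖f t‖ ^ 2)) (𝓝[<] κ)
      (𝓝 (κ ^ 2 * (∫ t in (0 : ℝ)..w, ‖f t‖ ^ 2))) :=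
    (Continuous.tendsto (by fun_prop) κ).mono_left nhdsWithin_le_nhds
  refine le_of_tendsto hlim ?_
  filter_upwards [Ioo_mem_nhdsLT hκ] with κ' hκ'
  exact poincare_interval_of_lt hf hf' h0 hw hκ'.1 hκ'.2 hκw hend

theorem poincare_symmetric_interval {F : Type*} [NormedAddCommGroup F] [InnerProductSpace ℝ F]
    {f f' : ℝ → F} (hf : ∀ t, HasDerivAt f (f' t) t) (hf' : Continuous f') (h0 : f 0 = 0)
    {w κ : ℝ} (hw : 0 ≤ w) (hκ : 0 < κ) (hκw : κ * w ≤ Real.pi)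
    (hend : (f w = 0 ∧ f (-w) = 0) ∨ κ * w ≤ Real.pi / 2) :
    κ ^ 2 * (∫ t in (-w)..w, ‖f t‖ ^ 2) ≤ ∫ t in (-w)..w, ‖f' t‖ ^ 2 := by
  have hfc : Continuous f := continuous_iff_continuousAt.2 fun t => (hf t).continuousAt
  have h1 := poincare_interval hf hf' h0 hw hκ hκw (hend.imp_left And.left)
  have h2 := poincare_interval (f := fun t => f (-t)) (f' := fun t => -f' (-t))
    (fun t => by simpa [Function.comp_def] using (hf (-t)).scomp t (hasDerivAt_neg t)) (by fun_prop)
    (by simpa using h0) hw hκ hκw (hend.imp_left And.right)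
  simp only [norm_neg] at h2
  rw [intervalIntegral.integral_comp_neg (fun t => ‖f t‖ ^ 2),
    intervalIntegral.integral_comp_neg (fun t => ‖f' t‖ ^ 2), neg_zero] at h2
  rw [← intervalIntegral.integral_add_adjacent_intervals (a := -w) (b := 0) (c := w)
      (f := fun t => ‖f t‖ ^ 2) (Continuous.intervalIntegrable (by fun_prop) _ _)
      (Continuous.intervalIntegrable (by fun_prop) _ _),
    ← intervalIntegral.integral_add_adjacent_intervals (a := -w) (b := 0) (c := w)
      (f := fun t => ‖f' t‖ ^ 2) (Continuous.intervalIntegrable (by fun_prop) _ _)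
      (Continuous.intervalIntegrable (by fun_prop) _ _)]
  linarith

/-- Fubini along the lines `x + y = s`. -/
theorem integral_eq_integral_antidiagonal {F : ℝ × ℝ → ℝ} (hF : Integrable F) :
    ∫ p, F p = ∫ s, ∫ t, F (t, s - t) := by
  have hmp : MeasurePreserving (fun z : ℝ × ℝ => (z.2, z.1 - z.2)) :=
    measurePreserving_prod_sub_swap volume volume
  have hint : Integrable fun z : ℝ × ℝ => F (z.2, z.1 - z.2) :=
    hmp.integrable_comp_of_integrable hF
  rw [← hmp.map_eq, integral_map hmp.measurable.aemeasurable
    (by rw [hmp.map_eq]; exact hF.aestronglyMeasurable)]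
  exact integral_prod _ hint

/-- The line `x + y = s` meets `Ω` in the segment `|x - y| ≤ min s d`. -/
theorem antidiagonal_mem_pairRegion_iff {d s τ : ℝ} :
    (s / 2 + τ, s / 2 - τ) ∈ pairRegion d ⊤ ↔ τ ∈ Set.Icc (-(min s d / 2)) (min s d / 2) := by
  simp only [pairRegion, wire, Set.mem_ofPred_eq, le_top, and_true, abs_le, Set.mem_Icc]
  constructor
  · rintro ⟨h1, h2, h3, h4⟩
    rcases min_choice s d with h | h <;> rw [h] <;> constructor <;> linarith
  · rintro ⟨h1, h2⟩
    have := min_le_left s d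
    have := min_le_right s d
    refine ⟨?_, ?_, ?_, ?_⟩ <;> linarith

/-- On each segment `x + y = const` an antisymmetric function vanishes in the middle, and for the
Dirichlet condition also at both ends, so that the Poincaré inequality applies. -/
theorem IsPairTest.lower_bound {bc : EndCondition} {d κ : ℝ} {u : ℝ × ℝ → ℂ}
    (hu : IsPairTest bc d ⊤ u) (hκ : 0 < κ) (hκd : κ * d ≤ 2 * Real.pi)
    (hbc : bc = EndCondition.dirichlet ∨ κ * d ≤ Real.pi) :
    κ ^ 2 / 2 * (∫ p in pairRegion d ⊤, ‖u p‖ ^ 2) ≤ dirichletEnergy (pairRegion d ⊤) u := by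
  set G : ℝ × ℝ → ℝ := fun p =>
    ‖fderiv ℝ u p (1, 0)‖ ^ 2 + ‖fderiv ℝ u p (0, 1)‖ ^ 2 - κ ^ 2 / 2 * ‖u p‖ ^ 2 with hG
  have hE : Integrable fun p =>
      ‖fderiv ℝ u p (1, 0)‖ ^ 2 + ‖fderiv ℝ u p (0, 1)‖ ^ 2 :=
    (hu.integrable_norm_sq_fderiv _).add (hu.integrable_norm_sq_fderiv _)
  have hN : Integrable fun p => κ ^ 2 / 2 * ‖u p‖ ^ 2 := hu.integrable_norm_sq.const_mul _
  have hGi : Integrable G := hE.sub hN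
  have hm := measurableSet_pairRegion_top d
  suffices h : 0 ≤ ∫ p in pairRegion d ⊤, G p by
    rw [hG, integral_sub hE.integrableOn hN.integrableOn, integral_const_mul] at h
    unfold dirichletEnergy
    linarith
  -- It suffices to integrate along each line `x + y = s`, centred at the diagonal point.
  rw [← integral_indicator hm, integral_eq_integral_antidiagonal (hGi.indicator hm)]
  refine integral_nonneg fun s => ?_
  rw [Pi.zero_apply, ← integral_add_left_eq_self _ (s / 2)]
  set w := min s d / 2 with hw
  have hpt (τ : ℝ) : (s / 2 + τ, s - (s / 2 + τ)) = (s / 2 + τ, s / 2 - τ) := by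
    rw [Prod.mk.injEq]; exact ⟨rfl, by ring⟩
  have hind : (fun τ => (pairRegion d ⊤).indicator G (s / 2 + τ, s - (s / 2 + τ))) =
      (Set.Icc (-w) w).indicator fun τ => G (s / 2 + τ, s / 2 - τ) := by
    ext τ
    rw [hpt]
    by_cases hτ : τ ∈ Set.Icc (-w) w
    · rw [Set.indicator_of_mem hτ, Set.indicator_of_mem (antidiagonal_mem_pairRegion_iff.2 hτ)]
    · rw [Set.indicator_of_notMem hτ,
        Set.indicator_of_notMem fun h => hτ (antidiagonal_mem_pairRegion_iff.1 h)]
  rw [hind, integral_indicator measurableSet_Icc]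
  rcases lt_or_ge w 0 with hneg | hw0
  · rw [Set.Icc_eq_empty (by linarith)]; simp
  rw [integral_Icc_eq_integral_Ioc, ← intervalIntegral.integral_of_le (by linarith)]
  have hc1 := hu.continuous_fderiv_apply (1, 0)
  have hc2 := hu.continuous_fderiv_apply (0, 1)
  have hc3 := hu.continuous_fderiv_apply (1, -1)
  have hc0 := hu.smooth.continuous
  have hline : Continuous fun τ : ℝ => (s / 2 + τ, s / 2 - τ) := by fun_prop
  have hder (τ : ℝ) : HasDerivAt (fun τ => u (s / 2 + τ, s / 2 - τ))
      (fderiv ℝ u (s / 2 + τ, s / 2 - τ) (1, -1)) τ := by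
    have h1 : HasDerivAt (fun τ : ℝ => (s / 2 + τ, s / 2 - τ)) ((1, -1) : ℝ × ℝ) τ :=
      ((hasDerivAt_id τ).const_add _).prodMk ((hasDerivAt_id τ).const_sub _)
    exact ((hu.smooth.differentiable (by simp)) _).hasFDerivAt.comp_hasDerivAt τ h1
  have hzero : u (s / 2 + 0, s / 2 - 0) = 0 := by
    have := hu.antisymmetric (s / 2, s / 2)
    rw [Prod.swap_prod_mk] at this
    simpa using self_eq_neg.1 this
  have hwd : w ≤ d / 2 := by have := min_le_right s d; linarith
  have hκw : κ * w ≤ κ * d / 2 := by nlinarith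
  have hend : (u (s / 2 + w, s / 2 - w) = 0 ∧ u (s / 2 + -w, s / 2 - -w) = 0) ∨
      κ * w ≤ Real.pi / 2 := by
    rcases hbc with hbc | hbc
    · left
      constructor <;> refine hu.eq_zero_of_notMem fun h => ?_
      all_goals
        obtain ⟨-, -, h3, h4⟩ := h
        obtain ⟨h4, h5⟩ := h4 hbc
        rw [abs_lt] at h3
        simp only at h3 h4 h5
        rcases min_choice s d with hs | hs <;> rw [hs] at hw <;> linarith [h3.1, h3.2]
    · right; linarith
  have key := poincare_symmetric_interval hder (hc3.comp hline) hzero hw0 hκ (by linarith) hend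
  -- The derivative along the segment is `∂ₓu - ∂ᵧu`, and `|a - b|² ≤ 2 (|a|² + |b|²)`.
  have hle : (∫ τ in (-w)..w, ‖fderiv ℝ u (s / 2 + τ, s / 2 - τ) (1, -1)‖ ^ 2 -
      κ ^ 2 * ‖u (s / 2 + τ, s / 2 - τ)‖ ^ 2) ≤
      ∫ τ in (-w)..w, 2 * G (s / 2 + τ, s / 2 - τ) := by
    refine intervalIntegral.integral_mono (by linarith)
      (Continuous.intervalIntegrable (by fun_prop) _ _)
      (Continuous.intervalIntegrable (by fun_prop) _ _) fun τ => ?_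
    set p : ℝ × ℝ := (s / 2 + τ, s / 2 - τ)
    have h1 : fderiv ℝ u p (1, -1) = fderiv ℝ u p (1, 0) - fderiv ℝ u p (0, 1) := by
      rw [← map_sub]; simp
    have h2 := parallelogram_law_with_norm ℝ (fderiv ℝ u p (1, 0)) (fderiv ℝ u p (0, 1))
    have h3 := mul_self_nonneg ‖fderiv ℝ u p (1, 0) + fderiv ℝ u p (0, 1)‖
    simp only [h1, hG]
    linarith
  rw [intervalIntegral.integral_const_mul, intervalIntegral.integral_sub
    (Continuous.intervalIntegrable (by fun_prop) _ _)
    (Continuous.intervalIntegrable (by fun_prop) _ _), intervalIntegral.integral_const_mul] at hle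
  linarith

/-! ### Trial functions for the Dirichlet condition -/

/-- The trial function `h(x - y) ψ(x + y)`: a profile `h` of the relative motion of the pair
times a profile `ψ` of its motion along the wire. -/
noncomputable def pairTrial (h ψ : ℝ → ℝ) (p : ℝ × ℝ) : ℂ :=
  ((h (p.1 - p.2) * ψ (p.1 + p.2) : ℝ) : ℂ)

/-- In the variables `x - y`, `x + y` the support of a product is a rectangle. -/
theorem exists_isCompact_of_mul_comp_ne_zero {A B : ℝ → ℝ} (hA : HasCompactSupport A)
    (hB : HasCompactSupport B) :
    ∃ K : Set (ℝ × ℝ), IsCompact K ∧ (∀ p ∈ K, p.1 - p.2 ∈ tsupport A ∧ p.1 + p.2 ∈ tsupport B) ∧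
      ∀ p : ℝ × ℝ, A (p.1 - p.2) * B (p.1 + p.2) ≠ 0 → p ∈ K := by
  refine ⟨(fun q : ℝ × ℝ => ((q.2 + q.1) / 2, (q.2 - q.1) / 2)) '' (tsupport A ×ˢ tsupport B),
    (hA.isCompact.prod hB.isCompact).image (by fun_prop), ?_, ?_⟩
  · rintro _ ⟨⟨a, b⟩, ⟨ha, hb⟩, rfl⟩
    constructor
    · convert! ha using 1; ring
    · convert! hb using 1; ring
  · intro p hp
    refine ⟨(p.1 - p.2, p.1 + p.2), ⟨subset_tsupport _ (left_ne_zero_of_mul hp),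
      subset_tsupport _ (right_ne_zero_of_mul hp)⟩, ?_⟩
    ext <;> ring

theorem integral_mul_comp_sub_add {A B : ℝ → ℝ} (hA : Continuous A) (hB : Continuous B)
    (hA' : HasCompactSupport A) (hB' : HasCompactSupport B) :
    Integrable (fun p : ℝ × ℝ => A (p.1 - p.2) * B (p.1 + p.2)) ∧
      ∫ p : ℝ × ℝ, A (p.1 - p.2) * B (p.1 + p.2) = 1 / 2 * ((∫ t, A t) * ∫ s, B s) := by
  have hint : Integrable (fun p : ℝ × ℝ => A (p.1 - p.2) * B (p.1 + p.2)) := by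
    obtain ⟨K, hK, -, hsupp⟩ := exists_isCompact_of_mul_comp_ne_zero hA' hB'
    refine Continuous.integrable_of_hasCompactSupport (by fun_prop)
      (HasCompactSupport.intro hK fun p hp => ?_)
    by_contra h
    exact hp (hsupp p h)
  refine ⟨hint, ?_⟩
  rw [integral_eq_integral_antidiagonal hint]
  have (s : ℝ) : ∫ t, A (t - (s - t)) * B (t + (s - t)) = 1 / 2 * (∫ t, A t) * B s := by
    -- Here `x - y = 2 t - s`, which is the source of the Jacobian.
    have h1 : ∀ t, A (t - (s - t)) * B (t + (s - t)) = A (2 * (t - s / 2)) * B s := fun t => by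
      congr 2 <;> ring
    simp_rw [h1]
    rw [integral_mul_const, integral_sub_right_eq_self (fun t => A (2 * t)) (s / 2),
      Measure.integral_comp_mul_left]
    simp
  simp_rw [this]
  rw [integral_const_mul]
  ring

theorem isPairTest_pairTrial {d : ℝ} {h ψ : ℝ → ℝ} (hh : ContDiff ℝ ∞ h) (hψ : ContDiff ℝ ∞ ψ)
    (hodd : ∀ t, h (-t) = -h t) (hhc : HasCompactSupport h) (hψc : HasCompactSupport ψ)
    (hhs : ∀ t ∈ tsupport h, |t| < d) (hψs : ∀ t ∈ tsupport ψ, d ≤ t) :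
    IsPairTest EndCondition.dirichlet d ⊤ (pairTrial h ψ) := by
  obtain ⟨K, hK, hKs, hsupp⟩ := exists_isCompact_of_mul_comp_ne_zero hhc hψc
  have hsub : Function.support (pairTrial h ψ) ⊆ K := fun p hp =>
    hsupp p fun h0 => hp (by rw [pairTrial, h0, Complex.ofReal_zero])
  refine ⟨?_, hK.of_isClosed_subset (isClosed_tsupport _) (closure_minimal hsub hK.isClosed),
    ?_, ?_⟩
  · refine Complex.ofRealCLM.contDiff.comp ?_
    exact (hh.comp (contDiff_fst.sub contDiff_snd)).mul (hψ.comp (contDiff_fst.add contDiff_snd))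
  · intro p hp
    obtain ⟨h1, h2⟩ := hKs p (closure_minimal hsub hK.isClosed hp)
    have h3 := hhs _ h1
    have h4 := hψs _ h2
    refine ⟨EReal.coe_lt_top _, EReal.coe_lt_top _, h3, fun _ => ?_⟩
    rw [abs_lt] at h3
    constructor <;> linarith
  · intro p
    rw [pairTrial, pairTrial, Prod.fst_swap, Prod.snd_swap, ← neg_sub p.1, hodd, add_comm p.2]
    push_cast
    ring

theorem fderiv_pairTrial {h ψ : ℝ → ℝ} (hh : Differentiable ℝ h) (hψ : Differentiable ℝ ψ)
    (p v : ℝ × ℝ) :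
    fderiv ℝ (pairTrial h ψ) p v =
      ((h (p.1 - p.2) * (deriv ψ (p.1 + p.2) * (v.1 + v.2)) +
        ψ (p.1 + p.2) * (deriv h (p.1 - p.2) * (v.1 - v.2)) : ℝ) : ℂ) := by
  have h1 : HasFDerivAt (fun p : ℝ × ℝ => h (p.1 - p.2)) _ p :=
    (hh _).hasDerivAt.comp_hasFDerivAt p
      ((hasFDerivAt_fst (𝕜 := ℝ) (E := ℝ) (F := ℝ)).sub hasFDerivAt_snd)
  have h2 : HasFDerivAt (fun p : ℝ × ℝ => ψ (p.1 + p.2)) _ p :=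
    (hψ _).hasDerivAt.comp_hasFDerivAt p
      ((hasFDerivAt_fst (𝕜 := ℝ) (E := ℝ) (F := ℝ)).add hasFDerivAt_snd)
  have h3 : HasFDerivAt (pairTrial h ψ) _ p :=
    Complex.ofRealCLM.hasFDerivAt.comp p (h1.mul h2)
  rw [h3.fderiv]
  simp
  ring

/-- Norm and energy of a trial function separate in the variables `x - y`, `x + y`; the factor
`1 / 2` is the Jacobian. -/
theorem pairTrial_integrals {d : ℝ} {h ψ : ℝ → ℝ} (hh : ContDiff ℝ ∞ h) (hψ : ContDiff ℝ ∞ ψ)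
    (hhc : HasCompactSupport h) (hψc : HasCompactSupport ψ)
    (hu : IsPairTest EndCondition.dirichlet d ⊤ (pairTrial h ψ)) :
    (∫ p in pairRegion d ⊤, ‖pairTrial h ψ p‖ ^ 2) = 1 / 2 * ((∫ t, h t ^ 2) * ∫ s, ψ s ^ 2) ∧
      dirichletEnergy (pairRegion d ⊤) (pairTrial h ψ) =
        (∫ t, deriv h t ^ 2) * (∫ s, ψ s ^ 2) + (∫ t, h t ^ 2) * ∫ s, deriv ψ s ^ 2 := by
  have hz : ∀ p ∉ pairRegion d ⊤, p ∉ testRegion EndCondition.dirichlet d ⊤ := fun p hp ht =>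
    hp ⟨⟨(ht.2.2.2 rfl).1.le, le_top⟩, ⟨(ht.2.2.2 rfl).2.le, le_top⟩, ht.2.2.1.le⟩
  have hhc' : Continuous (deriv h) := hh.continuous_deriv (by simp)
  have hψc' : Continuous (deriv ψ) := hψ.continuous_deriv (by simp)
  have sq_supp {A : ℝ → ℝ} (hA : HasCompactSupport A) : HasCompactSupport fun t => A t ^ 2 := by
    simp_rw [sq]; exact hA.mul_left
  have sq_cont {A : ℝ → ℝ} (hA : Continuous A) : Continuous fun t => A t ^ 2 := hA.pow 2
  constructor
  · rw [setIntegral_eq_integral_of_forall_compl_eq_zero fun p hp => by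
      simp [hu.eq_zero_of_notMem (hz p hp)]]
    rw [← (integral_mul_comp_sub_add (sq_cont hh.continuous) (sq_cont hψ.continuous)
      (sq_supp hhc) (sq_supp hψc)).2]
    congr 1 with p
    rw [pairTrial, Complex.norm_real, Real.norm_eq_abs, sq_abs, mul_pow]
  · unfold dirichletEnergy
    rw [setIntegral_eq_integral_of_forall_compl_eq_zero fun p hp => by
      simp [hu.fderiv_eq_zero_of_notMem (hz p hp)]]
    obtain ⟨i1, e1⟩ := integral_mul_comp_sub_add (sq_cont hhc') (sq_cont hψ.continuous)
      (sq_supp hhc.deriv) (sq_supp hψc)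
    obtain ⟨i2, e2⟩ := integral_mul_comp_sub_add (sq_cont hh.continuous) (sq_cont hψc')
      (sq_supp hhc) (sq_supp hψc.deriv)
    have hpt (p : ℝ × ℝ) : ‖fderiv ℝ (pairTrial h ψ) p (1, 0)‖ ^ 2 +
        ‖fderiv ℝ (pairTrial h ψ) p (0, 1)‖ ^ 2 =
        2 * (deriv h (p.1 - p.2) ^ 2 * ψ (p.1 + p.2) ^ 2) +
          2 * (h (p.1 - p.2) ^ 2 * deriv ψ (p.1 + p.2) ^ 2) := by
      rw [fderiv_pairTrial (hh.differentiable (by simp)) (hψ.differentiable (by simp)),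
        fderiv_pairTrial (hh.differentiable (by simp)) (hψ.differentiable (by simp)),
        Complex.norm_real, Complex.norm_real, Real.norm_eq_abs, Real.norm_eq_abs, sq_abs, sq_abs]
      ring
    simp_rw [hpt]
    rw [integral_add (i1.const_mul 2) (i2.const_mul 2), integral_const_mul, integral_const_mul,
      e1, e2]
    ring

/-- Factor of the relative profile: a smooth even cutoff which vanishes where
`|sin (π t / d)| ≤ 1 / n`. -/
noncomputable def sineCutoff (d : ℝ) (n : ℕ) (t : ℝ) : ℝ :=
  Real.smoothTransition (n ^ 2 * Real.sin (Real.pi / d * t) ^ 2 - 1)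

/-- The function `sin (π t / d)` on `|t| < d`, cut off smoothly near its zeros and continued
by `0`. The last factor is `0` for `|t| ≥ d`; the constant in it is so large that, for `|t| < d`,
it differs from `1` only where `sineCutoff` vanishes. -/
noncomputable def relativeProfile (d : ℝ) (n : ℕ) (t : ℝ) : ℝ :=
  Real.sin (Real.pi / d * t) * sineCutoff d n t *
    Real.smoothTransition (Real.pi * n / d ^ 2 * (d ^ 2 - t ^ 2))

section relativeProfile

variable {d : ℝ} {n : ℕ} {t : ℝ}

theorem sineCutoff_eq_zero (h : n * |Real.sin (Real.pi / d * t)| ≤ 1) : sineCutoff d n t = 0 := by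
  refine Real.smoothTransition.zero_of_nonpos ?_
  have h1 : (n * |Real.sin (Real.pi / d * t)|) ^ 2 ≤ 1 := pow_le_one₀ (by positivity) h
  rw [mul_pow, sq_abs] at h1
  linarith

theorem contDiff_sineCutoff : ContDiff ℝ ∞ (sineCutoff d n) :=
  Real.smoothTransition.contDiff.comp (by fun_prop)

theorem contDiff_relativeProfile : ContDiff ℝ ∞ (relativeProfile d n) :=
  (ContDiff.mul (by fun_prop) contDiff_sineCutoff).mul
    (Real.smoothTransition.contDiff.comp (by fun_prop))

theorem relativeProfile_neg : relativeProfile d n (-t) = -relativeProfile d n t := by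
  simp [relativeProfile, sineCutoff]

theorem relativeProfile_of_le (hd : 0 < d) (ht : d ≤ |t|) : relativeProfile d n t = 0 := by
  have h1 : d ^ 2 - t ^ 2 ≤ 0 := by
    rw [← sq_abs t]; nlinarith
  have h2 : Real.pi * n / d ^ 2 * (d ^ 2 - t ^ 2) ≤ 0 :=
    mul_nonpos_of_nonneg_of_nonpos (by positivity) h1
  rw [relativeProfile, Real.smoothTransition.zero_of_nonpos h2, mul_zero]

theorem abs_sin_le (hd : 0 < d) (ht : |t| ≤ d) :
    |Real.sin (Real.pi / d * t)| ≤ Real.pi / d * (d - |t|) := by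
  -- Reflection at the nearer end point, since the bound wanted is small near `|t| = d`.
  have h1 : |Real.sin (Real.pi / d * t)| = |Real.sin (Real.pi / d * (d - |t|))| := by
    have : Real.pi / d * (d - |t|) = Real.pi - Real.pi / d * |t| := by field_simp
    rw [this, Real.sin_pi_sub]
    rcases abs_choice t with h | h <;> rw [h]
    rw [mul_neg, Real.sin_neg, abs_neg]
  rw [h1]
  refine Real.abs_sin_le_abs.trans ?_
  rw [abs_of_nonneg]
  exact mul_nonneg (by positivity) (by linarith)

theorem relativeProfile_of_lt (hd : 0 < d) (ht : |t| < d) :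
    relativeProfile d n t = Real.sin (Real.pi / d * t) * sineCutoff d n t := by
  by_cases h : n * |Real.sin (Real.pi / d * t)| ≤ 1
  · rw [relativeProfile, sineCutoff_eq_zero h]; simp
  · have h1 := abs_sin_le hd ht.le
    push Not at h
    have h2 : 1 ≤ Real.pi * n / d ^ 2 * (d ^ 2 - t ^ 2) := by
      calc (1 : ℝ) ≤ n * (Real.pi / d * (d - |t|)) :=
            h.le.trans (mul_le_mul_of_nonneg_left h1 (by positivity))
        _ = Real.pi * n / d ^ 2 * ((d - |t|) * d) := by field_simp
        _ ≤ _ := by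
          refine mul_le_mul_of_nonneg_left ?_ (by positivity)
          rw [← sq_abs t]
          nlinarith [abs_nonneg t]
    rw [relativeProfile, Real.smoothTransition.one_of_one_le h2, mul_one]

/-- The support keeps away from `|t| = d`, since it lies where `|sin (π t / d)| ≥ 1 / n`. -/
theorem tsupport_relativeProfile_subset (hd : 0 < d) :
    tsupport (relativeProfile d n) ⊆
      {t | |t| ≤ d} ∩ {t | 1 ≤ n * |Real.sin (Real.pi / d * t)|} := by
  refine closure_minimal (fun _ ht => ?_)
    ((isClosed_le (by fun_prop) (by fun_prop)).inter (isClosed_le (by fun_prop) (by fun_prop)))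
  constructor
  · by_contra h
    exact ht (relativeProfile_of_le hd (not_le.1 h).le)
  · by_contra h
    exact ht (by rw [relativeProfile, sineCutoff_eq_zero (not_le.1 h).le]; simp)

theorem abs_lt_of_mem_tsupport (hd : 0 < d) (ht : t ∈ tsupport (relativeProfile d n)) :
    |t| < d := by
  obtain ⟨h1, h2⟩ := tsupport_relativeProfile_subset hd ht
  rw [Set.mem_ofPred_eq] at h1 h2
  refine lt_of_le_of_ne h1 fun h => ?_
  have := abs_sin_le hd h1
  rw [h, sub_self, mul_zero] at this
  have h0 := le_antisymm this (abs_nonneg _)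
  rw [h0, mul_zero] at h2
  linarith

theorem hasCompactSupport_relativeProfile (hd : 0 < d) :
    HasCompactSupport (relativeProfile d n) :=
  HasCompactSupport.intro (isCompact_Icc (a := -d) (b := d)) fun _ ht =>
    relativeProfile_of_le hd (not_le.1 fun h => ht (abs_le.1 h)).le

/-- The factor by which the cutoff changes the derivative of the sine, as a function of
`r = n² sin² (π t / d)`. -/
noncomputable def cutoffFactor (r : ℝ) : ℝ :=
  Real.smoothTransition (r - 1) + 2 * r * deriv Real.smoothTransition (r - 1)

theorem deriv_smoothTransition_of_one_lt {x : ℝ} (hx : 1 < x) :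
    deriv Real.smoothTransition x = 0 := by
  have : Real.smoothTransition =ᶠ[𝓝 x] fun _ => 1 := by
    filter_upwards [lt_mem_nhds hx] with y hy
    exact Real.smoothTransition.one_of_one_le hy.le
  rw [this.deriv_eq, deriv_const]

theorem cutoffFactor_of_two_lt {r : ℝ} (hr : 2 < r) : cutoffFactor r = 1 := by
  rw [cutoffFactor, Real.smoothTransition.one_of_one_le (by linarith),
    deriv_smoothTransition_of_one_lt (by linarith)]
  simp

theorem exists_abs_cutoffFactor_le : ∃ C : ℝ, ∀ r, 0 ≤ r → |cutoffFactor r| ≤ C := by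
  have hc : Continuous (deriv Real.smoothTransition) :=
    (Real.smoothTransition.contDiff (n := 1)).continuous_deriv le_rfl
  have hc' : Continuous cutoffFactor := by
    have := Real.smoothTransition.continuous
    unfold cutoffFactor
    fun_prop
  obtain ⟨C, hC⟩ := (isCompact_Icc (a := (0 : ℝ)) (b := 2)).exists_bound_of_continuousOn
    hc'.continuousOn
  refine ⟨max C 1, fun r hr => ?_⟩
  rcases le_or_gt r 2 with h | h
  · exact (hC r ⟨hr, h⟩).trans (le_max_left _ _)
  · rw [cutoffFactor_of_two_lt h, abs_one]; exact le_max_right _ _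

theorem deriv_relativeProfile_of_lt (hd : 0 < d) (ht : |t| < d) :
    deriv (relativeProfile d n) t = Real.pi / d * Real.cos (Real.pi / d * t) *
      cutoffFactor (n ^ 2 * Real.sin (Real.pi / d * t) ^ 2) := by
  have heq : relativeProfile d n =ᶠ[𝓝 t]
      fun t => Real.sin (Real.pi / d * t) * sineCutoff d n t := by
    filter_upwards [(continuous_abs.tendsto t).eventually_lt_const ht] with x hx
    exact relativeProfile_of_lt hd hx
  have hs : HasDerivAt (fun t => Real.sin (Real.pi / d * t))
      (Real.cos (Real.pi / d * t) * (Real.pi / d)) t := by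
    simpa using ((hasDerivAt_id t).const_mul (Real.pi / d)).sin
  have hT : HasDerivAt Real.smoothTransition _
      (n ^ 2 * Real.sin (Real.pi / d * t) ^ 2 - 1) :=
    ((Real.smoothTransition.contDiff (n := 1)).differentiable one_ne_zero _).hasDerivAt
  have hc : HasDerivAt (sineCutoff d n) _ t :=
    hT.comp t (((hs.pow 2).const_mul ((n : ℝ) ^ 2)).sub_const 1)
  rw [heq.deriv_eq, (hs.fun_mul hc).deriv, cutoffFactor, sineCutoff]
  push_cast
  ring

theorem deriv_relativeProfile_of_gt (hd : 0 < d) (ht : d < |t|) :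
    deriv (relativeProfile d n) t = 0 := by
  have heq : relativeProfile d n =ᶠ[𝓝 t] fun _ => 0 := by
    filter_upwards [(continuous_abs.tendsto t).eventually_const_lt ht] with x hx
    exact relativeProfile_of_le hd hx.le
  rw [heq.deriv_eq, deriv_const]

theorem sin_ne_zero_of_abs_lt (hd : 0 < d) (ht : |t| < d) (h0 : t ≠ 0) :
    Real.sin (Real.pi / d * t) ≠ 0 := by
  intro h
  have hpos : 0 < Real.pi / d := by positivity
  have h1 : |Real.pi / d * t| < Real.pi := by
    rw [abs_mul, abs_of_pos hpos]
    calc Real.pi / d * |t| < Real.pi / d * d := by gcongr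
      _ = Real.pi := by field_simp
  rw [abs_lt] at h1
  exact mul_ne_zero hpos.ne' h0 ((Real.sin_eq_zero_iff_of_lt_of_lt h1.1 h1.2).1 h)

theorem eventually_two_lt (hd : 0 < d) (ht : |t| < d) (h0 : t ≠ 0) :
    ∀ᶠ n : ℕ in atTop, 2 < (n : ℝ) ^ 2 * Real.sin (Real.pi / d * t) ^ 2 := by
  have hs : 0 < Real.sin (Real.pi / d * t) ^ 2 :=
    sq_pos_of_ne_zero (sin_ne_zero_of_abs_lt hd ht h0)
  have : Tendsto (fun n : ℕ => (n : ℝ) ^ 2 * Real.sin (Real.pi / d * t) ^ 2) atTop atTop :=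
    ((tendsto_pow_atTop two_ne_zero).comp tendsto_natCast_atTop_atTop).atTop_mul_const hs
  exact this.eventually_gt_atTop 2

theorem integral_Ioo_sin_sq (hd : 0 < d) :
    ∫ t in Set.Ioo (-d) d, Real.sin (Real.pi / d * t) ^ 2 = d := by
  rw [← integral_Ioc_eq_integral_Ioo, ← intervalIntegral.integral_of_le (by linarith),
    intervalIntegral.integral_comp_mul_left (fun x => Real.sin x ^ 2) (by positivity),
    integral_sin_sq]
  have h1 : Real.pi / d * d = Real.pi := by field_simp
  have h2 : Real.pi / d * -d = -Real.pi := by field_simp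
  rw [h1, h2, Real.sin_neg, Real.sin_pi]
  simp only [smul_eq_mul]
  field_simp
  ring

theorem integral_Ioo_cos_sq (hd : 0 < d) :
    ∫ t in Set.Ioo (-d) d, Real.cos (Real.pi / d * t) ^ 2 = d := by
  rw [← integral_Ioc_eq_integral_Ioo, ← intervalIntegral.integral_of_le (by linarith),
    intervalIntegral.integral_comp_mul_left (fun x => Real.cos x ^ 2) (by positivity),
    integral_cos_sq]
  have h1 : Real.pi / d * d = Real.pi := by field_simp
  have h2 : Real.pi / d * -d = -Real.pi := by field_simp
  rw [h1, h2, Real.sin_neg, Real.sin_pi]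
  simp only [smul_eq_mul]
  field_simp
  ring

theorem tendsto_integral_relativeProfile_sq (hd : 0 < d) :
    Tendsto (fun n => ∫ t, relativeProfile d n t ^ 2) atTop (𝓝 d) := by
  have hset (n : ℕ) : ∫ t, relativeProfile d n t ^ 2 =
      ∫ t in Set.Ioo (-d) d, relativeProfile d n t ^ 2 :=
    (setIntegral_eq_integral_of_forall_compl_eq_zero fun t ht => by
      rw [relativeProfile_of_le hd (not_lt.1 fun h => ht (abs_lt.1 h)), zero_pow two_ne_zero]).symm
  simp_rw [hset]
  suffices h : Tendsto (fun n => ∫ t in Set.Ioo (-d) d, relativeProfile d n t ^ 2) atTop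
      (𝓝 (∫ t in Set.Ioo (-d) d, Real.sin (Real.pi / d * t) ^ 2)) by
    rwa [integral_Ioo_sin_sq hd] at h
  refine tendsto_integral_of_dominated_convergence (fun _ => 1)
    (fun n => (contDiff_relativeProfile.continuous.pow 2).aestronglyMeasurable)
    (integrable_const _) (fun n => ?_) ?_
  · filter_upwards [ae_restrict_mem measurableSet_Ioo] with t ht
    rw [relativeProfile_of_lt hd (abs_lt.2 ht), Real.norm_eq_abs, abs_pow, abs_mul, sineCutoff,
      abs_of_nonneg (Real.smoothTransition.nonneg _)]
    exact pow_le_one₀ (mul_nonneg (abs_nonneg _) (Real.smoothTransition.nonneg _))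
      (mul_le_one₀ (Real.abs_sin_le_one _) (Real.smoothTransition.nonneg _)
        (Real.smoothTransition.le_one _))
  · filter_upwards [ae_restrict_mem measurableSet_Ioo, Measure.ae_ne _ (0 : ℝ)] with t ht h0
    refine tendsto_const_nhds.congr' ?_
    filter_upwards [eventually_two_lt hd (abs_lt.2 ht) h0] with n hn
    rw [relativeProfile_of_lt hd (abs_lt.2 ht), sineCutoff,
      Real.smoothTransition.one_of_one_le (by linarith), mul_one]

/-- The smooth cutoff costs no kinetic energy in the limit: its derivative is multiplied by the
sine, which is of order `1 / n` where the cutoff varies, so `cutoffFactor` is bounded and dominated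
convergence applies. -/
theorem tendsto_integral_deriv_relativeProfile_sq (hd : 0 < d) :
    Tendsto (fun n => ∫ t, deriv (relativeProfile d n) t ^ 2) atTop
      (𝓝 ((Real.pi / d) ^ 2 * d)) := by
  have hset (n : ℕ) : ∫ t, deriv (relativeProfile d n) t ^ 2 =
      ∫ t in Set.Ioo (-d) d, deriv (relativeProfile d n) t ^ 2 := by
    rw [← integral_Icc_eq_integral_Ioo]
    exact (setIntegral_eq_integral_of_forall_compl_eq_zero fun t ht => by
      rw [deriv_relativeProfile_of_gt hd (not_le.1 fun h => ht (abs_le.1 h)),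
        zero_pow two_ne_zero]).symm
  simp_rw [hset]
  obtain ⟨C, hC⟩ := exists_abs_cutoffFactor_le
  have hlim : (Real.pi / d) ^ 2 * d =
      ∫ t in Set.Ioo (-d) d, (Real.pi / d * Real.cos (Real.pi / d * t)) ^ 2 := by
    simp_rw [mul_pow]
    rw [integral_const_mul, integral_Ioo_cos_sq hd]
  rw [hlim]
  refine tendsto_integral_of_dominated_convergence (fun _ => (Real.pi / d * 1 * C) ^ 2)
    (fun n => ((contDiff_relativeProfile.continuous_deriv (by simp)).pow 2).aestronglyMeasurable)
    (integrable_const _) (fun n => ?_) ?_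
  · filter_upwards [ae_restrict_mem measurableSet_Ioo] with t ht
    rw [deriv_relativeProfile_of_lt hd (abs_lt.2 ht), Real.norm_eq_abs, abs_pow, abs_mul, abs_mul,
      abs_of_pos (by positivity : 0 < Real.pi / d)]
    gcongr
    · exact Real.abs_cos_le_one _
    · exact hC _ (by positivity)
  · filter_upwards [ae_restrict_mem measurableSet_Ioo, Measure.ae_ne _ (0 : ℝ)] with t ht h0
    refine tendsto_const_nhds.congr' ?_
    filter_upwards [eventually_two_lt hd (abs_lt.2 ht) h0] with n hn
    rw [deriv_relativeProfile_of_lt hd (abs_lt.2 ht), cutoffFactor_of_two_lt hn, mul_one]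

end relativeProfile

/-- A bump supported in `[1, 3]`. -/
noncomputable def unitBump : ContDiffBump (2 : ℝ) := ⟨1 / 2, 1, by norm_num, by norm_num⟩

/-- The bump moved to `[d + R, d + 3 R]`: spread over the length `R` its kinetic energy per unit
mass is of order `R⁻²`. -/
noncomputable def longProfile (d R s : ℝ) : ℝ := unitBump (R⁻¹ * (s - d))

theorem contDiff_longProfile (d R : ℝ) : ContDiff ℝ ∞ (longProfile d R) :=
  unitBump.contDiff.comp (by fun_prop)

theorem support_longProfile_subset {d R : ℝ} (hR : 0 < R) :
    tsupport (longProfile d R) ⊆ Set.Icc d (d + 3 * R) := by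
  refine closure_minimal (fun s hs => ?_) isClosed_Icc
  have h1 : R⁻¹ * (s - d) ∈ Function.support unitBump := hs
  rw [unitBump.support_eq, Real.ball_eq_Ioo] at h1
  obtain ⟨h2, h3⟩ := h1
  simp only [unitBump] at h2 h3
  rw [inv_mul_eq_div] at h2 h3
  rw [lt_div_iff₀ hR] at h2
  rw [div_lt_iff₀ hR] at h3
  constructor <;> linarith

theorem hasCompactSupport_longProfile {d R : ℝ} (hR : 0 < R) :
    HasCompactSupport (longProfile d R) :=
  isCompact_Icc.of_isClosed_subset (isClosed_tsupport _) (support_longProfile_subset hR)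

theorem integral_longProfile_sq {d R : ℝ} (hR : 0 < R) :
    ∫ s, longProfile d R s ^ 2 = R * ∫ s, unitBump s ^ 2 := by
  unfold longProfile
  rw [integral_sub_right_eq_self (fun s => unitBump (R⁻¹ * s) ^ 2) d,
    Measure.integral_comp_mul_left (fun s => unitBump s ^ 2)]
  simp [abs_of_pos hR]

theorem integral_deriv_longProfile_sq {d R : ℝ} (hR : 0 < R) :
    ∫ s, deriv (longProfile d R) s ^ 2 = R⁻¹ * ∫ s, deriv unitBump s ^ 2 := by
  have hder (s : ℝ) : deriv (longProfile d R) s = deriv unitBump (R⁻¹ * (s - d)) * R⁻¹ := by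
    have h1 : HasDerivAt (fun s => R⁻¹ * (s - d)) R⁻¹ s := by
      simpa using ((hasDerivAt_id s).sub_const d).const_mul R⁻¹
    exact ((unitBump.contDiff (n := 1)).differentiable one_ne_zero _).hasDerivAt.comp s h1 |>.deriv
  simp_rw [hder, mul_pow]
  rw [integral_mul_const, integral_sub_right_eq_self (fun s => deriv unitBump (R⁻¹ * s) ^ 2) d,
    Measure.integral_comp_mul_left (fun s => deriv unitBump s ^ 2)]
  simp only [inv_inv, abs_of_pos hR, smul_eq_mul]
  field_simp

theorem integral_unitBump_sq_pos : 0 < ∫ s, unitBump s ^ 2 := by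
  have hc : Continuous fun s => unitBump s ^ 2 := unitBump.continuous.pow 2
  refine hc.integral_pos_of_hasCompactSupport_nonneg_nonzero ?_ (fun s => by positivity) (x := 2) ?_
  · simp_rw [sq]; exact unitBump.hasCompactSupport.mul_left
  · rw [unitBump.one_of_mem_closedBall (Metric.mem_closedBall_self unitBump.rIn_pos.le)]
    norm_num

theorem isPairTest_trial {d R : ℝ} (hd : 0 < d) (hR : 0 < R) (n : ℕ) :
    IsPairTest EndCondition.dirichlet d ⊤ (pairTrial (relativeProfile d n) (longProfile d R)) :=
  isPairTest_pairTrial contDiff_relativeProfile (contDiff_longProfile d R)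
    (fun _ => relativeProfile_neg) (hasCompactSupport_relativeProfile hd)
    (hasCompactSupport_longProfile hR) (fun _ => abs_lt_of_mem_tsupport hd)
    (fun _ ht => (support_longProfile_subset hR ht).1)

/-- Rayleigh's principle for the trial functions, after the limit `n → ∞`. -/
theorem bulkGroundEnergy_dirichlet_le_add {d R : ℝ} (hd : 0 < d) (hR : 0 < R) :
    bulkGroundEnergy EndCondition.dirichlet d ≤ 2 * Real.pi ^ 2 / d ^ 2 +
      2 * ((∫ s, deriv unitBump s ^ 2) / ∫ s, unitBump s ^ 2) * (R⁻¹) ^ 2 := by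
  set B := ∫ s, unitBump s ^ 2 with hB
  set B' := ∫ s, deriv unitBump s ^ 2 with hB'
  have hBpos : 0 < B := integral_unitBump_sq_pos
  set E₀ := bulkGroundEnergy EndCondition.dirichlet d
  have h1 (n : ℕ) : E₀ * (1 / 2 * ((∫ t, relativeProfile d n t ^ 2) * (R * B))) ≤
      (∫ t, deriv (relativeProfile d n) t ^ 2) * (R * B) +
        (∫ t, relativeProfile d n t ^ 2) * (R⁻¹ * B') := by
    have hu := isPairTest_trial hd hR n
    have h := bulkGroundEnergy_mul_le hu
    obtain ⟨e1, e2⟩ := pairTrial_integrals contDiff_relativeProfile (contDiff_longProfile d R)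
      (hasCompactSupport_relativeProfile hd) (hasCompactSupport_longProfile hR) hu
    rwa [e1, e2, integral_longProfile_sq hR, integral_deriv_longProfile_sq hR] at h
  have hN := tendsto_integral_relativeProfile_sq hd
  have h2 := le_of_tendsto_of_tendsto'
    (((hN.mul_const (R * B)).const_mul (1 / 2)).const_mul E₀)
    (((tendsto_integral_deriv_relativeProfile_sq hd).mul_const (R * B)).add
      (hN.mul_const (R⁻¹ * B'))) h1
  have h3 : E₀ * (d * R * B / 2) ≤ (2 * Real.pi ^ 2 / d ^ 2 + 2 * (B' / B) * R⁻¹ ^ 2) *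
      (d * R * B / 2) := by
    calc E₀ * (d * R * B / 2) = E₀ * (1 / 2 * (d * (R * B))) := by ring
      _ ≤ _ := h2
      _ = _ := by field_simp
  exact le_of_mul_le_mul_right h3 (by positivity)

theorem bulkGroundEnergy_dirichlet_le {d : ℝ} (hd : 0 < d) :
    bulkGroundEnergy EndCondition.dirichlet d ≤ 2 * Real.pi ^ 2 / d ^ 2 := by
  have hlim := ((tendsto_inv_atTop_zero (𝕜 := ℝ)).pow 2).const_mul
    (2 * ((∫ s, deriv unitBump s ^ 2) / ∫ s, unitBump s ^ 2)) |>.const_add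
    (2 * Real.pi ^ 2 / d ^ 2)
  rw [zero_pow two_ne_zero, mul_zero, add_zero] at hlim
  refine ge_of_tendsto hlim ?_
  filter_upwards [eventually_gt_atTop 0] with R hR
  exact bulkGroundEnergy_dirichlet_le_add hd hR

theorem exists_isPairTest_integral_pos (bc : EndCondition) {d : ℝ} (hd : 0 < d) :
    ∃ u, IsPairTest bc d ⊤ u ∧ 0 < ∫ p in pairRegion d ⊤, ‖u p‖ ^ 2 := by
  obtain ⟨n, hn⟩ := ((tendsto_integral_relativeProfile_sq hd).eventually_const_lt hd).exists
  have hu := isPairTest_trial hd one_pos n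
  refine ⟨_, hu.of_dirichlet, ?_⟩
  rw [(pairTrial_integrals contDiff_relativeProfile (contDiff_longProfile d 1)
    (hasCompactSupport_relativeProfile hd) (hasCompactSupport_longProfile one_pos) hu).1,
    integral_longProfile_sq one_pos]
  have := integral_unitBump_sq_pos
  positivity

/-! ### The ground state energy -/

theorem bulkGroundEnergy_dirichlet {d : ℝ} (hd : 0 < d) :
    bulkGroundEnergy EndCondition.dirichlet d = 2 * Real.pi ^ 2 / d ^ 2 := by
  refine le_antisymm (bulkGroundEnergy_dirichlet_le hd) ?_
  refine le_bulkGroundEnergy (fun u hu => ?_) (exists_isPairTest_integral_pos _ hd)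
  have h := hu.lower_bound (κ := 2 * Real.pi / d) (by positivity) (by field_simp; rfl) (Or.inl rfl)
  convert! h using 2
  ring

/-- The energy `π² / (2 d²)` bounds the form from below for both boundary conditions. -/
theorem bulkGroundEnergy_pos (bc : EndCondition) {d : ℝ} (hd : 0 < d) :
    0 < bulkGroundEnergy bc d := by
  refine lt_of_lt_of_le (by positivity : 0 < (Real.pi / d) ^ 2 / 2)
    (le_bulkGroundEnergy (fun u hu => ?_) (exists_isPairTest_integral_pos _ hd))
  have h1 : Real.pi / d * d = Real.pi := by field_simp
  exact hu.lower_bound (by positivity) (by linarith [Real.pi_pos]) (Or.inr h1.le)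

/-! ### Destruction of the condensate -/

/-- If the energy stays above the chemical potential by a fixed gap, the occupation numbers are
bounded, so their densities tend to `0`. -/
theorem tendsto_occupation_density_of_gap {β c : ℝ} (hβ : 0 < β) (hc : 0 < c) {x L : ℕ → ℝ}
    (hL : Tendsto L atTop atTop) (hx : ∀ᶠ k in atTop, c ≤ x k) :
    Tendsto (fun k => 1 / L k * boseOccupation β (x k)) atTop (𝓝 0) := by
  have h0 : Tendsto (fun k => 1 / L k * boseOccupation β c) atTop (𝓝 0) := by
    simpa using (tendsto_inv_atTop_zero.comp hL).mul_const (boseOccupation β c)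
  have hpos : 0 < Real.exp (β * c) - 1 := by
    rw [sub_pos, Real.one_lt_exp_iff]; positivity
  refine squeeze_zero' ?_ ?_ h0
  · filter_upwards [hx, hL.eventually_gt_atTop 0] with k hk hLk
    have : 0 ≤ Real.exp (β * x k) - 1 := by
      rw [sub_nonneg, Real.one_le_exp_iff]
      exact mul_nonneg hβ.le (hc.le.trans hk)
    unfold boseOccupation
    positivity
  · filter_upwards [hx, hL.eventually_gt_atTop 0] with k hk hLk
    unfold boseOccupation
    gcongr

/-- The surface density is at most `(L / n) ρ`, asymptotically; this bounds the chemical potential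
by `lam * δ * ρ - α`, which lies below the bottom of the bulk spectrum. -/
theorem condensate_destroyed {bc : EndCondition} {d α β lam ρ δ : ℝ} (hβ : 0 < β) (hlam : 0 < lam)
    (hρ : 0 < ρ) {e : ℕ → ℝ} {n : ℝ → ℕ} {E : ℝ → ℕ → ℝ} {φ : (ℓ : ℝ) → ℕ → PairL2 d (ℓ : EReal)}
    (hE : ∀ ℓ : ℝ, 0 < ℓ → IsPairEigensystem bc d (ℓ : EReal) (E ℓ) (φ ℓ))
    {μ ρs : ℝ → ℝ} {L : ℕ → ℝ} (hL : ∀ k, 0 < L k) (hLtop : Tendsto L atTop atTop)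
    (hδ : Tendsto (fun k => L k / (n (L k) : ℝ)) atTop (𝓝 δ))
    (hμ : ∀ k, μ (L k) < lam * ρs (L k) - α)
    (hρs : ∀ k, ρs (L k) =
      1 / (n (L k) : ℝ) * surfaceNumber β α lam e (n (L k)) (μ (L k)) (ρs (L k)))
    (hdensity : Tendsto
      (fun k => (ENNReal.ofReal
          (surfaceNumber β α lam e (n (L k)) (μ (L k)) (ρs (L k)))
        + bulkNumber β (E (L k)) (μ (L k))) / ENNReal.ofReal (L k))
      atTop (𝓝 (ENNReal.ofReal ρ)))
    (hgap : lam * (δ * ρ) < bulkGroundEnergy bc d + α) (m : ℕ) :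
    Tendsto (fun k => 1 / L k * boseOccupation β (E (L k) m - μ (L k))) atTop (𝓝 0) := by
  set S : ℕ → ℝ := fun k => surfaceNumber β α lam e (n (L k)) (μ (L k)) (ρs (L k)) with hS
  have hlim : Tendsto (fun t : ℝ => lam * (δ * t)) (𝓝[>] ρ) (𝓝 (lam * (δ * ρ))) :=
    ((continuous_const.mul (continuous_const.mul continuous_id)).tendsto ρ).mono_left
      nhdsWithin_le_nhds
  -- `ρ'` exceeds the limit density `ρ` so slightly that the gap persists.
  obtain ⟨ρ', hρ'1, hρ'2 : ρ < ρ'⟩ :=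
    ((hlim.eventually_lt_const hgap).and self_mem_nhdsWithin).exists
  -- The bulk term of the density is dropped here; only its nonnegativity matters.
  have hSle : ∀ᶠ k in atTop, S k / L k ≤ ρ' := by
    have hlt : ENNReal.ofReal ρ < ENNReal.ofReal ρ' :=
      (ENNReal.ofReal_lt_ofReal_iff (hρ.trans hρ'2)).2 hρ'2
    filter_upwards [hdensity.eventually_lt_const hlt] with k hk
    have h1 : ENNReal.ofReal (S k / L k) ≤ ENNReal.ofReal ρ' := by
      rw [ENNReal.ofReal_div_of_pos (hL k)]
      refine le_trans ?_ hk.le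
      gcongr
      exact le_self_add
    exact (ENNReal.ofReal_le_ofReal_iff (hρ.trans hρ'2).le).1 h1
  obtain ⟨a, ha1, ha2⟩ := exists_between hρ'1
  have hlim2 : Tendsto (fun k => lam * (L k / (n (L k) : ℝ) * ρ')) atTop (𝓝 (lam * (δ * ρ'))) :=
    (hδ.mul_const ρ').const_mul lam
  refine tendsto_occupation_density_of_gap hβ (sub_pos.2 ha2) hLtop ?_
  filter_upwards [hSle, hlim2.eventually_lt_const ha1] with k hk1 hk2
  have h1 : ρs (L k) ≤ L k / (n (L k) : ℝ) * ρ' := by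
    calc ρs (L k) = L k / (n (L k) : ℝ) * (S k / L k) := by
          have hk : ρs (L k) = 1 / (n (L k) : ℝ) * S k := hρs k
          rw [hk, div_mul_div_comm, mul_comm (n (L k) : ℝ), mul_div_mul_left _ _ (hL k).ne',
            one_div_mul_eq_div]
      _ ≤ _ := by
          have := hL k
          gcongr
  have h2 : lam * ρs (L k) ≤ lam * (L k / (n (L k) : ℝ) * ρ') := by gcongr
  have h3 := bulkGroundEnergy_le_eigenvalue ((hE _ (hL k)).orthonormal.1 m) ((hE _ (hL k)).eigen m)
  linarith [hμ k]

theorem mainTheorem5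
    (bc : EndCondition) (d α β lam ρ δ : ℝ)
    (hd : 0 < d) (hα : 0 ≤ α) (hβ : 0 < β) (hlam : 0 < lam) (hρ : 0 < ρ)
    -- edge weights of the surface graph
    (e : ℕ → ℝ) (he : ∀ i, 0 ≤ e i)
    -- number of surface defects up to length `ℓ`
    (n : ℝ → ℕ) (hn : ∀ ℓ : ℝ, 0 < ℓ → 0 < n ℓ)
    -- eigenvalues and eigenfunctions of the pair Hamiltonian on `[0, ℓ]`
    (E : ℝ → ℕ → ℝ) (φ : (ℓ : ℝ) → ℕ → PairL2 d (ℓ : EReal))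
    (hE : ∀ ℓ : ℝ, 0 < ℓ → IsPairEigensystem bc d (ℓ : EReal) (E ℓ) (φ ℓ))
    -- chemical potentials and surface pair densities
    (μ ρs : ℝ → ℝ)
    -- the lengths along which the thermodynamic limit is taken
    (L : ℕ → ℝ) (hL : ∀ k, 0 < L k) (hLtop : Tendsto L atTop atTop)
    (hδ : Tendsto (fun k => L k / (n (L k) : ℝ)) atTop (𝓝 δ))
    (hμ : ∀ k, μ (L k) < min (lam * ρs (L k) - α) (E (L k) 0))
    (hρs : ∀ k, ρs (L k) =
      1 / (n (L k) : ℝ) * surfaceNumber β α lam e (n (L k)) (μ (L k)) (ρs (L k)))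
    (hdensity : Tendsto
      (fun k => (ENNReal.ofReal
          (surfaceNumber β α lam e (n (L k)) (μ (L k)) (ρs (L k)))
        + bulkNumber β (E (L k)) (μ (L k))) / ENNReal.ofReal (L k))
      atTop (𝓝 (ENNReal.ofReal ρ))) :
    -- the value of `E₀`
    (bc = EndCondition.dirichlet → bulkGroundEnergy bc d = 2 * Real.pi ^ 2 / d ^ 2) ∧
    -- destruction of the condensate for `δ = 0`
    (δ = 0 → ∀ m : ℕ, Tendsto
      (fun k => 1 / L k * boseOccupation β (E (L k) m - μ (L k))) atTop (𝓝 0)) ∧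
    -- destruction of the condensate for small `δ * ρ`
    (∀ ν : ℝ, 1 < ν → δ * ρ < (bulkGroundEnergy bc d + α) / (ν * lam) →
      ∀ m : ℕ, Tendsto
        (fun k => 1 / L k * boseOccupation β (E (L k) m - μ (L k))) atTop (𝓝 0)) := by
  have hδ0 : 0 ≤ δ := ge_of_tendsto' hδ fun k => div_nonneg (hL k).le (Nat.cast_nonneg _)
  have hμ' (k : ℕ) : μ (L k) < lam * ρs (L k) - α := (hμ k).trans_le (min_le_left _ _)
  have hpos := bulkGroundEnergy_pos bc hd
  refine ⟨fun hbc => hbc ▸ bulkGroundEnergy_dirichlet hd, fun h0 m => ?_, fun ν hν hlt m => ?_⟩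
  · refine condensate_destroyed hβ hlam hρ hE hL hLtop hδ hμ' hρs hdensity ?_ m
    rw [h0, zero_mul, mul_zero]
    linarith
  · refine condensate_destroyed hβ hlam hρ hE hL hLtop hδ hμ' hρs hdensity ?_ m
    rw [lt_div_iff₀ (by positivity)] at hlt
    have h1 : 0 ≤ lam * (δ * ρ) := by positivity
    nlinarith
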